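/- For $k\ge 1$, $\zeta\in\mathbb{R}$ and $1\le j\le k+1$, let $\lambda_{k,j}(\zeta)$, respectively $\widehat\lambda_{k,j}(\zeta)$, denote the supremum in $[-\infty,\infty]$ of all $\eta\in\mathbb{R}$ such that the system $$|x|\le X,\qquad \max_{1\le i\le k}|\zeta^i x-y_i|\le X^{-\eta}$$ has at least $j$ linearly independent solutions $(x,y_1,\dots,y_k)\in\mathbb{Z}^{k+1}$ for arbitrarily large real $X$, respectively for all sufficiently large real $X$. **Theorem.** Let $k$ be a positive integer and let $q_1,q_2,\dots$ be positive integers with $q_l\mid q_{l+1}$ and $q_l<q_{l+1}$ for all $l\ge 1$. Suppose that for every real $C>0$ there is an index $n\geq 1$ with $q_n>1$ such that $$\frac{\log q_{n+1}}{\log q_n}>C\qquad\text{and}\qquad \frac{\log q_{n+2}}{\log q_{n+1}}>k+1 .$$ Then the series $\zeta=\sum_{l\ge 1}1/q_l$ converges, and $$\lambda_{k,1}(\zeta)=\infty,\qquad \lambda_{k,j}(\zeta)=\frac1{j-1}\quad(2\le j\le k+1),$$ $$\widehat\lambda_{k,1}(\zeta)=\frac1k,\qquad \widehat\lambda_{k,j}(\zeta)=0\quad(2\le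 j\le k+1).$$ -/

import Mathlib

open Filter

/-- `v = (x, y₁, …, y_k) ∈ ℤ^(k+1)` solves the system
`|x| ≤ X`, `max_{1 ≤ i ≤ k} |ζ_i x - y_i| ≤ X^(-η)`. -/
def IsApproxSolution {k : ℕ} (ζ : Fin k → ℝ) (η X : ℝ) (v : Fin (k + 1) → ℤ) : Prop :=
  |(v 0 : ℝ)| ≤ X ∧ ∀ i : Fin k, |ζ i * (v 0 : ℝ) - (v i.succ : ℝ)| ≤ X ^ (-η)

/-- The system with parameters `η` and `X` has at least `j` linearly independent
integer solutions. -/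
def HasIndepSolutions {k : ℕ} (ζ : Fin k → ℝ) (j : ℕ) (η X : ℝ) : Prop :=
  ∃ v : Fin j → Fin (k + 1) → ℤ,
    LinearIndependent ℤ v ∧ ∀ a : Fin j, IsApproxSolution ζ η X (v a)

/-- `λ_{k,j}(ζ₁, …, ζ_k)`: the supremum, in the extended reals, of the real `η` for which the
system has `j` linearly independent solutions for arbitrarily large real `X`. -/
noncomputable def approxConst {k : ℕ} (ζ : Fin k → ℝ) (j : ℕ) : EReal :=
  sSup ((fun η : ℝ => (η : EReal)) '' {η : ℝ | ∃ᶠ X : ℝ in atTop, HasIndepSolutions ζ j η X})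

/-- `\hat λ_{k,j}(ζ₁, …, ζ_k)`: the same with "for all sufficiently large real `X`". -/
noncomputable def uniformApproxConst {k : ℕ} (ζ : Fin k → ℝ) (j : ℕ) : EReal :=
  sSup ((fun η : ℝ => (η : EReal)) '' {η : ℝ | ∀ᶠ X : ℝ in atTop, HasIndepSolutions ζ j η X})

/-- The vector `(ζ, ζ², …, ζ^k)`. -/
def succPowers (k : ℕ) (ζ : ℝ) : Fin k → ℝ := fun i => ζ ^ ((i : ℕ) + 1)

/-! Everything rests on two consecutive partial sums, α = p/N and β = α + 1/M, with M beyond any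
prescribed power of N and 0 ≤ ζ - β ≤ 2/M^(k+1) (`HasLacunaryApprox`).

Ordinary constants: expand N^k β^i in powers of 1/M, multiply by M^m and drop the negative powers of
M. For 0 ≤ m < j this gives independent integer vectors with x = N^k M^m and error O(N^k/M). Since N
is negligible against M, X = N^k M^(j-1) gives every η with η(j-1) < 1, so every η when j = 1
(`frequently_hasIndepSolutions`). Conversely, a nonzero integer j×j minor is at least 1 in absolute
value but O(X^(1-(j-1)η)) (`one_le_of_hasIndepSolutions`).

Uniform constants: for j ≥ 2, unit vectors give every η < 0, while at X = N^K all solutions lie on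
the line through (1, α, …, α^k). For j = 1, Dirichlet gives 1/k. It is sharp: if β = a/b in lowest
terms and X is a small multiple of b^k, a solution has b^k ∣ x, hence x = 0. -/

/-! ### Partial sums of the lacunary series. -/

theorem two_pow_le_of_dvd_of_lt {q : ℕ → ℕ} (hpos : ∀ l, 0 < q l)
    (hdvd : ∀ l, q l ∣ q (l + 1)) (hlt : ∀ l, q l < q (l + 1)) (n l : ℕ) :
    2 ^ l * q n ≤ q (n + l) := by
  induction l with
  | zero => simp
  | succ l ih =>
    obtain ⟨c, hc⟩ := hdvd (n + l)
    have h1 := hlt (n + l)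
    have h2 := hpos (n + l)
    have hc2 : 2 ≤ c := by
      by_contra h
      have : c ≤ 1 := by omega
      nlinarith
    calc 2 ^ (l + 1) * q n = (2 ^ l * q n) * 2 := by ring
      _ ≤ q (n + l) * c := Nat.mul_le_mul ih hc2
      _ = q (n + (l + 1)) := hc.symm

theorem inv_le_geometric {q : ℕ → ℕ} (hpos : ∀ l, 0 < q l)
    (hdvd : ∀ l, q l ∣ q (l + 1)) (hlt : ∀ l, q l < q (l + 1)) (n l : ℕ) :
    1 / (q (l + n) : ℝ) ≤ 1 / (q n : ℝ) * (1 / 2) ^ l := by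
  have h := two_pow_le_of_dvd_of_lt hpos hdvd hlt n l
  have hq : (0 : ℝ) < q n := by exact_mod_cast hpos n
  have h' : (2 : ℝ) ^ l * q n ≤ q (l + n) := by rw [add_comm l n]; exact_mod_cast h
  calc 1 / (q (l + n) : ℝ) ≤ 1 / ((2 : ℝ) ^ l * q n) :=
        one_div_le_one_div_of_le (by positivity) h'
    _ = 1 / (q n : ℝ) * (1 / 2) ^ l := by
        rw [one_div_pow]; field_simp

theorem summable_one_div {q : ℕ → ℕ} (hpos : ∀ l, 0 < q l)
    (hdvd : ∀ l, q l ∣ q (l + 1)) (hlt : ∀ l, q l < q (l + 1)) :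
    Summable (fun l : ℕ => 1 / (q l : ℝ)) :=
  Summable.of_nonneg_of_le (fun l => by positivity)
    (fun l => inv_le_geometric hpos hdvd hlt 0 l)
    ((summable_geometric_of_lt_one (by norm_num) (by norm_num)).mul_left _)

theorem tsum_sub_partial_sum_mem {q : ℕ → ℕ} (hpos : ∀ l, 0 < q l)
    (hdvd : ∀ l, q l ∣ q (l + 1)) (hlt : ∀ l, q l < q (l + 1)) (n : ℕ) :
    0 ≤ (∑' l, 1 / (q l : ℝ)) - ∑ l ∈ Finset.range n, 1 / (q l : ℝ) ∧
      (∑' l, 1 / (q l : ℝ)) - ∑ l ∈ Finset.range n, 1 / (q l : ℝ) ≤ 2 / (q n : ℝ) := by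
  have hs := summable_one_div hpos hdvd hlt
  have heq : (∑' l, 1 / (q l : ℝ)) - ∑ l ∈ Finset.range n, 1 / (q l : ℝ)
      = ∑' l, 1 / (q (l + n) : ℝ) := by
    rw [← hs.sum_add_tsum_nat_add n]; ring
  rw [heq]
  refine ⟨tsum_nonneg fun l => by positivity, ?_⟩
  have hg : Summable fun l : ℕ => 1 / (q n : ℝ) * (1 / 2 : ℝ) ^ l :=
    (summable_geometric_of_lt_one (by norm_num) (by norm_num)).mul_left _
  calc ∑' l, 1 / (q (l + n) : ℝ) ≤ ∑' l : ℕ, 1 / (q n : ℝ) * (1 / 2 : ℝ) ^ l :=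
        ((summable_nat_add_iff n).2 hs).tsum_le_tsum (inv_le_geometric hpos hdvd hlt n) hg
    _ = 2 / (q n : ℝ) := by
        rw [tsum_mul_left, tsum_geometric_two]; ring

theorem exists_partial_sum_eq_div {q : ℕ → ℕ} (hpos : ∀ l, 0 < q l)
    (hdvd : ∀ l, q l ∣ q (l + 1)) (n : ℕ) :
    ∃ p : ℕ, ∑ l ∈ Finset.range (n + 1), 1 / (q l : ℝ) = p / q n := by
  induction n with
  | zero => exact ⟨1, by simp⟩
  | succ n ih =>
    obtain ⟨p, hp⟩ := ih
    obtain ⟨c, hc⟩ := hdvd n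
    have h0 : (q n : ℝ) ≠ 0 := by exact_mod_cast (hpos n).ne'
    have h1 : (q (n + 1) : ℝ) ≠ 0 := by exact_mod_cast (hpos (n + 1)).ne'
    have hc' : (q (n + 1) : ℝ) = q n * c := by exact_mod_cast hc
    have hc0 : (c : ℝ) ≠ 0 := by rintro h; apply h1; rw [hc', h, mul_zero]
    refine ⟨p * c + 1, ?_⟩
    rw [Finset.sum_range_succ, hp, hc']
    push_cast
    field_simp

theorem pow_lt_of_lt_log_div_log {a b m : ℕ} (ha : 1 < a) (hb : 0 < b)
    (h : (m : ℝ) < Real.log b / Real.log a) : a ^ m < b := by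
  have hl : 0 < Real.log a := Real.log_pos (by exact_mod_cast ha)
  rw [lt_div_iff₀ hl, ← Real.log_pow] at h
  have := (Real.log_lt_log_iff (by positivity) (by exact_mod_cast hb)).1 h
  exact_mod_cast this

/-- `ζ` has, at arbitrarily large scales, a rational approximation `p / N` whose error is much
smaller than any power of `1 / N`, followed by the approximation `p / N + 1 / M`
with error at most `2 / M ^ (k + 1)`. -/
def HasLacunaryApprox (k : ℕ) (ζ : ℝ) : Prop :=
  ∀ C B : ℕ, ∃ N M p : ℕ, B ≤ N ∧ 2 ≤ N ∧ N ∣ M ∧ N ^ C < M ∧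
    0 ≤ ζ - p / N ∧ ζ - p / N ≤ 2 / M ∧
    0 ≤ ζ - (p / N + 1 / M) ∧ ζ - (p / N + 1 / M) ≤ 2 / (M : ℝ) ^ (k + 1)

theorem hasLacunaryApprox_of_growth {k : ℕ} {q : ℕ → ℕ}
    (hpos : ∀ l, 0 < q l) (hdvd : ∀ l, q l ∣ q (l + 1)) (hlt : ∀ l, q l < q (l + 1))
    (hgrowth : ∀ C : ℝ, 0 < C → ∃ n : ℕ, 1 < q n ∧
      C < Real.log (q (n + 1) : ℝ) / Real.log (q n : ℝ) ∧
      (k : ℝ) + 1 < Real.log (q (n + 2) : ℝ) / Real.log (q (n + 1) : ℝ)) :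
    HasLacunaryApprox k (∑' l, 1 / (q l : ℝ)) := by
  intro C B
  -- Adding all ratios of index below B to the threshold forces n ≥ B, so q n > n is as large as
  -- required.
  obtain ⟨n, hn1, hC, hk⟩ := hgrowth
    ((C : ℝ) + 1 + ∑ l ∈ Finset.range B, |Real.log (q (l + 1) : ℝ) / Real.log (q l : ℝ)|)
    (by positivity)
  have hsum : 0 ≤ ∑ l ∈ Finset.range B, |Real.log (q (l + 1) : ℝ) / Real.log (q l : ℝ)| :=
    Finset.sum_nonneg fun _ _ => abs_nonneg _
  have hBn : B ≤ n := by
    by_contra h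
    have h1 := Finset.single_le_sum
      (f := fun l => |Real.log (q (l + 1) : ℝ) / Real.log (q l : ℝ)|)
      (fun i _ => abs_nonneg _) (Finset.mem_range.2 (not_le.1 h))
    have h2 := le_abs_self (Real.log (q (n + 1) : ℝ) / Real.log (q n : ℝ))
    have h3 : (0 : ℝ) ≤ C := by positivity
    linarith
  have hq : n < q n := by
    have h1 := two_pow_le_of_dvd_of_lt hpos hdvd hlt 0 n
    have h2 := hpos 0
    have h3 : n < 2 ^ n := Nat.lt_two_pow_self
    rw [zero_add] at h1
    nlinarith
  have hR : (q (n + 1)) ^ (k + 1) < q (n + 2) :=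
    pow_lt_of_lt_log_div_log (hn1.trans (hlt n)) (hpos _) (by exact_mod_cast hk)
  obtain ⟨p, hp⟩ := exists_partial_sum_eq_div hpos hdvd n
  have t1 := tsum_sub_partial_sum_mem hpos hdvd hlt (n + 1)
  have t2 := tsum_sub_partial_sum_mem hpos hdvd hlt (n + 2)
  rw [Finset.sum_range_succ] at t2
  rw [hp] at t1 t2
  have hM : (0 : ℝ) < q (n + 1) := by exact_mod_cast hpos _
  refine ⟨q n, q (n + 1), p, by omega, by omega, hdvd n,
    pow_lt_of_lt_log_div_log hn1 (hpos _) (by linarith), t1.1, t1.2, t2.1, t2.2.trans ?_⟩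
  exact div_le_div_of_nonneg_left (by norm_num) (by positivity) (by exact_mod_cast hR.le)

/-! ### Suprema in the extended reals and a Lipschitz bound for powers. -/

theorem sSup_coe_image_eq {S : Set ℝ} {c : ℝ} (h1 : ∀ η < c, η ∈ S) (h2 : ∀ η > c, η ∉ S) :
    sSup ((fun η : ℝ => (η : EReal)) '' S) = (c : EReal) := by
  apply le_antisymm
  · apply sSup_le
    rintro _ ⟨η, hη, rfl⟩
    exact EReal.coe_le_coe_iff.2 (not_lt.1 fun h => h2 η h hη)
  · refine le_of_forall_lt fun b hb => ?_
    obtain ⟨r, hr1, hr2⟩ := EReal.lt_iff_exists_real_btwn.1 hb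
    exact hr1.trans_le (le_sSup ⟨r, h1 r (EReal.coe_lt_coe_iff.1 hr2), rfl⟩)

theorem sSup_coe_image_eq_top {S : Set ℝ} (h : ∀ η, η ∈ S) :
    sSup ((fun η : ℝ => (η : EReal)) '' S) = ⊤ := by
  rw [EReal.eq_top_iff_forall_lt]
  intro y
  exact (EReal.coe_lt_coe_iff.2 (lt_add_one y)).trans_le (le_sSup ⟨y + 1, h _, rfl⟩)

theorem exists_pow_sub_pow_le (k : ℕ) (ζ : ℝ) : ∃ A : ℝ, 1 ≤ A ∧ ∀ α : ℝ, 0 ≤ α → α ≤ ζ →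
    ∀ i ≤ k, |ζ ^ i - α ^ i| ≤ A * (ζ - α) := by
  refine ⟨k * (1 + |ζ|) ^ k + 1, by linarith [show (0 : ℝ) ≤ k * (1 + |ζ|) ^ k by positivity], ?_⟩
  intro α h0 h1 i hi
  have hζ : 0 ≤ ζ := h0.trans h1
  have h := abs_pow_sub_pow_le (α := ℝ) ζ α i
  rw [abs_of_nonneg (sub_nonneg.2 h1), abs_of_nonneg hζ, abs_of_nonneg h0, max_eq_left h1] at h
  rw [abs_of_nonneg hζ]
  have h2 : ζ ^ (i - 1) ≤ (1 + ζ) ^ k :=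
    (pow_le_pow_left₀ hζ (by linarith) _).trans (pow_le_pow_right₀ (by linarith) (by omega))
  have h3 : (i : ℝ) ≤ k := by exact_mod_cast hi
  have h4 : (i : ℝ) * ζ ^ (i - 1) ≤ k * (1 + ζ) ^ k + 1 := by
    have : (i : ℝ) * ζ ^ (i - 1) ≤ k * (1 + ζ) ^ k := by gcongr
    linarith
  calc _ ≤ _ := h
    _ = (i * ζ ^ (i - 1)) * (ζ - α) := by ring
    _ ≤ _ := mul_le_mul_of_nonneg_right h4 (sub_nonneg.2 h1)

/-! ### Upper bound for the ordinary constants, by minors. -/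

/-- Over ℚ the row rank j equals the column rank, so j independent columns can be selected. -/
theorem exists_minor_ne_zero {j m : ℕ} {v : Fin j → Fin m → ℤ} (hv : LinearIndependent ℤ v) :
    ∃ f : Fin j → Fin m, (Matrix.of fun a b => v a (f b)).det ≠ 0 := by
  have h := (linearIndependent_algebraMap_comp_iff (R := ℤ) (S := ℚ)).2 hv
  set V : Matrix (Fin j) (Fin m) ℚ := Matrix.of fun a b => (v a b : ℚ) with hV
  have hr : V.rank = j := by
    have : LinearIndependent ℚ V.row := h
    simpa using this.rank_matrix
  rw [Matrix.rank_eq_finrank_span_cols] at hr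
  obtain ⟨g, hg, -, hli⟩ := Submodule.exists_fun_fin_finrank_span_eq ℚ (Set.range V.col)
  choose f hf using hg
  refine ⟨f ∘ Fin.cast hr.symm, fun h0 => ?_⟩
  have hcol : LinearIndependent ℚ (V.submatrix id (f ∘ Fin.cast hr.symm)).col := by
    have : (V.submatrix id (f ∘ Fin.cast hr.symm)).col = g ∘ Fin.cast hr.symm := by
      ext b a
      exact congrFun (hf _) a
    rw [this]
    exact hli.comp _ (Fin.cast_injective _)
  have hu := (Matrix.isUnit_iff_isUnit_det _).1 (Matrix.linearIndependent_cols_iff_isUnit.1 hcol)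
  have hmap : V.submatrix id (f ∘ Fin.cast hr.symm) = (Matrix.of fun a b =>
      v a ((f ∘ Fin.cast hr.symm) b)).map (Int.castRingHom ℚ) := by
    ext a b; simp [hV]
  rw [hmap, ← RingHom.mapMatrix_apply, ← RingHom.map_det, h0, map_zero] at hu
  exact not_isUnit_zero hu

theorem abs_det_le_of_row_bounds {j : ℕ} (A : Matrix (Fin j) (Fin j) ℝ) (r : Fin j) {P Q : ℝ}
    (hP : ∀ b, |A r b| ≤ P) (hQ : ∀ a ≠ r, ∀ b, |A a b| ≤ Q) :
    |A.det| ≤ (j.factorial : ℝ) * (P * Q ^ (j - 1)) := by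
  rw [← Matrix.det_transpose, Matrix.det_apply]
  refine (Finset.abs_sum_le_sum_abs _ _).trans ?_
  have h : ∀ σ ∈ (Finset.univ : Finset (Equiv.Perm (Fin j))),
      |Equiv.Perm.sign σ • ∏ i, A.transpose (σ i) i| ≤ P * Q ^ (j - 1) := by
    intro σ _
    have hs : |Equiv.Perm.sign σ • ∏ i, A.transpose (σ i) i| = ∏ i, |A i (σ i)| := by
      rw [← Finset.abs_prod]
      rcases Int.units_eq_one_or (Equiv.Perm.sign σ) with h | h <;> simp [h, Matrix.transpose_apply]
    rw [hs, ← Finset.mul_prod_erase _ _ (Finset.mem_univ r)]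
    have hcard : (Finset.univ.erase r).card = j - 1 := by simp
    refine mul_le_mul (hP _) ?_ (by positivity) ((abs_nonneg _).trans (hP r))
    rw [← hcard]
    rw [← Finset.prod_const]
    exact Finset.prod_le_prod (fun _ _ => abs_nonneg _)
      fun a ha => hQ a (Finset.ne_of_mem_erase ha) _
  refine (Finset.sum_le_card_nsmul _ _ _ h).trans ?_
  simp [Fintype.card_perm]

theorem one_le_of_hasIndepSolutions {k : ℕ} (ζ : Fin k → ℝ) {Z : ℝ} (hZ1 : 1 ≤ Z)
    (hZ : ∀ i, |ζ i| ≤ Z) {j : ℕ} (hj : 1 ≤ j) {η X : ℝ} (hη : 0 ≤ η) (hX : 1 ≤ X)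
    (h : HasIndepSolutions ζ j η X) :
    1 ≤ (j.factorial : ℝ) * (((Z + 1) * X) * (2 * X ^ (-η)) ^ (j - 1)) := by
  obtain ⟨v, hli, hv⟩ := h
  obtain ⟨f, hf⟩ := exists_minor_ne_zero hli
  have : NeZero j := ⟨by omega⟩
  -- Pivoting on the largest |x| keeps the multipliers t a = x_a / x_r in [-1, 1]. Row reduction
  -- then cancels the x-coordinates, and the other entries become combinations of two approximation
  -- errors.
  obtain ⟨r, -, hr⟩ := Finset.exists_max_image Finset.univ (fun a => |(v a 0 : ℝ)|)
    ⟨(0 : Fin j), Finset.mem_univ _⟩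
  set t : Fin j → ℝ := fun a => if a = r then 0 else (v a 0 : ℝ) / v r 0 with ht
  set V : Matrix (Fin j) (Fin j) ℝ := Matrix.of fun a b => (v a (f b) : ℝ) with hV
  set A : Matrix (Fin j) (Fin j) ℝ := Matrix.of fun a b => (v a (f b) : ℝ) - t a * v r (f b) with hA
  have htr : t r = 0 := by simp [ht]
  have hdet : V.det = A.det := by
    refine Matrix.det_eq_of_forall_row_eq_smul_add_const t r htr fun a b => ?_
    simp [hA, hV, htr]
  have hVdet : 1 ≤ |V.det| := by
    have : V = (Matrix.of fun a b => v a (f b)).map (Int.cast : ℤ → ℝ) := by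
      ext a b; simp [hV]
    have h2 : V.det = (((Matrix.of fun a b => v a (f b)).det : ℤ) : ℝ) := by
      rw [this]; exact ((Int.castRingHom ℝ).map_det _).symm
    rw [h2, ← Int.cast_abs]
    exact_mod_cast Int.one_le_abs hf
  have hXη : X ^ (-η) ≤ 1 := Real.rpow_le_one_of_one_le_of_nonpos hX (by linarith)
  have hXη0 : 0 ≤ X ^ (-η) := Real.rpow_nonneg (by linarith) _
  rw [hdet] at hVdet
  refine hVdet.trans (abs_det_le_of_row_bounds A r ?_ ?_)
  · intro b
    simp only [hA, Matrix.of_apply, htr, zero_mul, sub_zero]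
    have h0 := (hv r).1
    refine Fin.cases ?_ (fun i => ?_) (f b)
    · nlinarith
    · have h1 := (hv r).2 i
      have h2 : |ζ i * (v r 0 : ℝ)| ≤ Z * X := by
        rw [abs_mul]; exact mul_le_mul (hZ i) h0 (abs_nonneg _) (by linarith)
      rw [abs_le] at *
      constructor <;> nlinarith [h1.1, h1.2, h2.1, h2.2]
  · intro a ha b
    simp only [hA, Matrix.of_apply]
    have hta : |t a| ≤ 1 := by
      simp only [ht, if_neg ha, abs_div]
      exact div_le_one_of_le₀ (hr a (Finset.mem_univ _)) (abs_nonneg _)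
    have htx : t a * v r 0 = v a 0 := by
      simp only [ht, if_neg ha]
      -- If the maximal |x| is 0, all x vanish, and division by zero gives t a = 0 consistently.
      by_cases h0 : (v r 0 : ℝ) = 0
      · have := hr a (Finset.mem_univ _)
        simp only [h0, abs_zero] at this
        rw [h0, mul_zero]
        exact (abs_nonpos_iff.1 this).symm
      · field_simp
    refine Fin.cases ?_ (fun i => ?_) (f b)
    · rw [htx, sub_self, abs_zero]; linarith
    · have h1 := (hv a).2 i
      have h2 := (hv r).2 i
      have e : (v a i.succ : ℝ) - t a * v r i.succ
          = t a * (ζ i * v r 0 - v r i.succ) - (ζ i * v a 0 - v a i.succ) := by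
        rw [← htx]; ring
      rw [e]
      refine (abs_sub _ _).trans ?_
      rw [abs_mul]
      have := mul_le_mul hta h2 (abs_nonneg _) zero_le_one
      linarith

theorem not_frequently_hasIndepSolutions {k : ℕ} (ζ : Fin k → ℝ) {j : ℕ} (hj : 2 ≤ j) {η : ℝ}
    (hη : 1 / ((j : ℝ) - 1) < η) : ¬ ∃ᶠ X : ℝ in atTop, HasIndepSolutions ζ j η X := by
  rw [not_frequently]
  have hj1 : (0 : ℝ) < (j : ℝ) - 1 := by
    have : (2 : ℝ) ≤ j := by exact_mod_cast hj
    linarith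
  have hη0 : 0 < η := lt_trans (by positivity) hη
  have hpos : 0 < η * ((j : ℝ) - 1) - 1 := by
    rw [div_lt_iff₀ hj1] at hη; linarith
  obtain ⟨Z, hZ⟩ : ∃ Z : ℝ, ∀ i, |ζ i| ≤ Z :=
    ⟨∑ i, |ζ i|, fun i => Finset.single_le_sum (f := fun i => |ζ i|)
      (fun _ _ => abs_nonneg _) (Finset.mem_univ i)⟩
  set D : ℝ := (j.factorial : ℝ) * ((max Z 1 + 1) * 2 ^ (j - 1)) with hD
  have hlim : Tendsto (fun X : ℝ => D * X ^ (-(η * ((j : ℝ) - 1) - 1))) atTop (nhds 0) := by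
    simpa using (tendsto_rpow_neg_atTop hpos).const_mul D
  filter_upwards [hlim.eventually_lt_const zero_lt_one, eventually_ge_atTop 1] with X h1 hX h
  have h2 := one_le_of_hasIndepSolutions ζ (le_max_right Z 1)
    (fun i => (hZ i).trans (le_max_left _ _)) (by omega) hη0.le hX h
  have hX0 : 0 < X := by linarith
  have e : (j.factorial : ℝ) * (((max Z 1 + 1) * X) * (2 * X ^ (-η)) ^ (j - 1))
      = D * X ^ (-(η * ((j : ℝ) - 1) - 1)) := by
    have : X ^ (-(η * ((j : ℝ) - 1) - 1)) = X * (X ^ (-η)) ^ (j - 1) := by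
      rw [← Real.rpow_natCast, ← Real.rpow_mul hX0.le, Nat.cast_sub (by omega)]
      nth_rw 2 [← Real.rpow_one X]
      rw [← Real.rpow_add hX0]
      congr 1; push_cast; ring
    rw [this, hD, mul_pow]; ring
  linarith

/-! ### Lower bound for the ordinary constants, by truncated expansions. -/

/-- The integers `C(i, s) p ^ (i - s) N ^ (k - (i - s))`, the coefficients of
`N ^ k (p / N + t) ^ i` as a polynomial in `t`. -/
def expansionMatrix (k N p : ℕ) : Matrix (Fin (k + 1)) (Fin (k + 1)) ℤ :=
  Matrix.of fun s i => (((i : ℕ).choose s * p ^ ((i : ℕ) - s) * N ^ (k - ((i : ℕ) - s)) : ℕ) : ℤ)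

/-- The lower triangular matrix with entries `M ^ (m - s)`, `s ≤ m`. -/
def truncationMatrix (k M : ℕ) : Matrix (Fin (k + 1)) (Fin (k + 1)) ℤ :=
  Matrix.of fun m s => if s ≤ m then (M : ℤ) ^ ((m : ℕ) - s) else 0

/-- The first factor is lower triangular with diagonal 1, the second upper triangular with diagonal
N^k. -/
theorem det_truncationMatrix_mul_expansionMatrix_ne_zero (k M p : ℕ) {N : ℕ} (hN : N ≠ 0) :
    (truncationMatrix k M * expansionMatrix k N p).det ≠ 0 := by
  rw [Matrix.det_mul, Matrix.det_of_isLowerTriangular, Matrix.det_of_isUpperTriangular]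
  · simp [truncationMatrix, expansionMatrix, hN]
  · intro i j hij
    have : (j : ℕ) < i := hij
    simp [expansionMatrix, Nat.choose_eq_zero_of_lt this]
  · intro i j hij
    have : i < j := hij
    simp [truncationMatrix, not_le.2 this]

theorem sum_expansionMatrix_mul_pow (k p : ℕ) {N : ℕ} (hN : N ≠ 0) (i : Fin (k + 1)) (t : ℝ) :
    ∑ s, (expansionMatrix k N p s i : ℝ) * t ^ (s : ℕ) = (N : ℝ) ^ k * (p / N + t) ^ (i : ℕ) := by
  have hN' : (N : ℝ) ≠ 0 := by exact_mod_cast hN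
  rw [add_comm ((p : ℝ) / N) t, add_pow, Finset.mul_sum]
  simp only [expansionMatrix, Matrix.of_apply, Int.cast_natCast]
  rw [Fin.sum_univ_eq_sum_range (fun s => (((i : ℕ).choose s * p ^ ((i : ℕ) - s) *
    N ^ (k - ((i : ℕ) - s)) : ℕ) : ℝ) * t ^ s)]
  symm
  refine (Finset.sum_congr rfl fun s hs => ?_).trans (Finset.sum_subset
    (Finset.range_subset_range.2 (by omega : (i : ℕ) + 1 ≤ k + 1)) fun s _ hs => ?_)
  · have hd : (N : ℝ) ^ k = N ^ (k - ((i : ℕ) - s)) * N ^ ((i : ℕ) - s) := by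
      rw [← pow_add]; congr 1; omega
    rw [hd, div_pow]
    push_cast
    field_simp
  · rw [Nat.choose_eq_zero_of_lt (by simpa using hs)]; simp

theorem truncationMatrix_mul_expansionMatrix_zero (k N M p : ℕ) (m : Fin (k + 1)) :
    (truncationMatrix k M * expansionMatrix k N p) m 0 = (N : ℤ) ^ k * (M : ℤ) ^ (m : ℕ) := by
  rw [Matrix.mul_apply, Finset.sum_eq_single 0]
  · simp [truncationMatrix, expansionMatrix, mul_comm]
  · intro s _ hs
    have : 0 < (s : ℕ) := Nat.pos_of_ne_zero fun h => hs (Fin.ext h)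
    simp [expansionMatrix, Nat.choose_eq_zero_of_lt this]
  · simp

/-- Terms with s ≤ m are reproduced exactly; each dropped one carries M^(m-s) ≤ 1/M, and the
coefficients are summed by putting t = 1. -/
theorem abs_truncation_sub_le (k p : ℕ) {N M : ℕ} (hN : N ≠ 0) (hM : 1 ≤ M) (m i : Fin (k + 1)) :
    |(N : ℝ) ^ k * M ^ (m : ℕ) * (p / N + 1 / M) ^ (i : ℕ)
      - ((truncationMatrix k M * expansionMatrix k N p) m i : ℝ)|
      ≤ (N : ℝ) ^ k / M * (p / N + 1) ^ (i : ℕ) := by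
  have hM' : (1 : ℝ) ≤ M := by exact_mod_cast hM
  have hM0 : (0 : ℝ) < M := by linarith
  have e1 : (N : ℝ) ^ k * M ^ (m : ℕ) * (p / N + 1 / M) ^ (i : ℕ)
      = ∑ s, (expansionMatrix k N p s i : ℝ) * ((M : ℝ) ^ (m : ℕ) * (1 / M) ^ (s : ℕ)) := by
    rw [mul_right_comm, ← sum_expansionMatrix_mul_pow k p hN i, Finset.sum_mul]
    exact Finset.sum_congr rfl fun _ _ => by ring
  have e2 : (N : ℝ) ^ k / M * (p / N + 1) ^ (i : ℕ)
      = ∑ s, (expansionMatrix k N p s i : ℝ) * (1 / M) := by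
    rw [div_mul_eq_mul_div, ← sum_expansionMatrix_mul_pow k p hN i, ← Finset.sum_mul]
    simp [div_eq_mul_inv]
  rw [e1, e2, Matrix.mul_apply]
  push_cast
  rw [← Finset.sum_sub_distrib]
  refine (Finset.abs_sum_le_sum_abs _ _).trans (Finset.sum_le_sum fun s _ => ?_)
  have hW : (0 : ℝ) ≤ expansionMatrix k N p s i := by
    simp only [expansionMatrix, Matrix.of_apply, Int.cast_natCast]; positivity
  rw [mul_comm ((truncationMatrix k M m s : ℤ) : ℝ), ← mul_sub, abs_mul, abs_of_nonneg hW]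
  refine mul_le_mul_of_nonneg_left ?_ hW
  simp only [truncationMatrix, Matrix.of_apply]
  split_ifs with h
  · have h' : (s : ℕ) ≤ m := h
    have : (M : ℝ) ^ (m : ℕ) * (1 / M) ^ (s : ℕ) = M ^ ((m : ℕ) - s) := by
      rw [pow_sub₀ _ hM0.ne' h', one_div, inv_pow]
    rw [this]
    push_cast
    simp
  · have h' : (m : ℕ) + 1 ≤ s := not_le.1 h
    rw [Int.cast_zero, sub_zero, abs_of_nonneg (by positivity), one_div_pow,
      ← div_eq_mul_one_div, div_le_div_iff₀ (by positivity) hM0, one_mul, ← pow_succ]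
    exact pow_le_pow_right₀ hM' h'

theorem frequently_hasIndepSolutions {k : ℕ} (hk : 1 ≤ k) {ζ : ℝ} (hL : HasLacunaryApprox k ζ)
    {j : ℕ} (hj : 1 ≤ j) (hjk : j ≤ k + 1) {η : ℝ} (hη : η * ((j : ℝ) - 1) < 1) :
    ∃ᶠ X : ℝ in atTop, HasIndepSolutions (succPowers k ζ) j η X := by
  rw [frequently_atTop]
  intro a
  obtain ⟨A, hA1, hA⟩ := exists_pow_sub_pow_le k ζ
  -- 2A pays for replacing ζ by β, and (ζ+1)^k for the truncation.
  set c : ℝ := 2 * A + (ζ + 1) ^ k with hc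
  set η' := max η 0 with hη'
  have hη0 : 0 ≤ η' := le_max_right _ _
  set ε : ℝ := 1 - ((j : ℝ) - 1) * η' with hε
  have hε0 : 0 < ε := by
    rcases max_choice η 0 with h | h <;> rw [hε, hη', h] <;> linarith
  -- As c ≤ N, the bound c N^k / M ≤ X^(-η') follows from N^(k + kη' + 1) ≤ M^ε, which M > N^C
  -- ensures.
  obtain ⟨C, hC⟩ := exists_nat_ge ((k + k * η' + 1) / ε)
  obtain ⟨B, hB⟩ := exists_nat_ge (max a c)
  obtain ⟨N, M, p, hBN, hN2, -, hNM, h1, -, h3, h4⟩ := hL C B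
  have hN0 : N ≠ 0 := by omega
  have hNr : (2 : ℝ) ≤ N := by exact_mod_cast hN2
  have hNpos : (0 : ℝ) < N := by linarith
  have hM1 : 1 ≤ M := by omega
  have hMr : (1 : ℝ) ≤ M := by exact_mod_cast hM1
  have hMpos : (0 : ℝ) < M := by linarith
  have hBN' : max a c ≤ N := hB.trans (by exact_mod_cast hBN)
  have haN : a ≤ N := (le_max_left _ _).trans hBN'
  have hcN : c ≤ N := (le_max_right _ _).trans hBN'
  set X : ℝ := (N : ℝ) ^ k * M ^ (j - 1) with hX
  have hNX : (N : ℝ) ≤ X := by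
    have h5 : (N : ℝ) ≤ N ^ k := le_self_pow₀ (by linarith) (by omega)
    have h6 : (1 : ℝ) ≤ M ^ (j - 1) := one_le_pow₀ hMr
    nlinarith
  have hX1 : 1 ≤ X := by linarith
  have hα0 : (0 : ℝ) ≤ p / N := by positivity
  have hβ : (p : ℝ) / N + 1 / M ≤ ζ := by linarith
  have hbound : (N : ℝ) ^ k / M * c ≤ X ^ (-η) := by
    have s1 : X ^ (-η') ≤ X ^ (-η) :=
      Real.rpow_le_rpow_of_exponent_le hX1 (neg_le_neg (le_max_left _ _))
    refine le_trans ?_ s1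
    have s2 : (N : ℝ) ^ (k + k * η' + 1) ≤ (M : ℝ) ^ ε := by
      calc (N : ℝ) ^ (k + k * η' + 1) ≤ (N : ℝ) ^ (C * ε) :=
            Real.rpow_le_rpow_of_exponent_le (by linarith) ((div_le_iff₀ hε0).1 hC)
        _ = ((N : ℝ) ^ C) ^ ε := by rw [Real.rpow_mul hNpos.le, Real.rpow_natCast]
        _ ≤ _ := Real.rpow_le_rpow (by positivity) (by exact_mod_cast hNM.le) hε0.le
    have s3 : X ^ (-η') = (N : ℝ) ^ (-(k * η')) * ((M : ℝ) ^ ε / M) := by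
      rw [hX, Real.mul_rpow (by positivity) (by positivity), ← Real.rpow_natCast,
        ← Real.rpow_natCast, ← Real.rpow_mul hNpos.le, ← Real.rpow_mul hMpos.le,
        ← Real.rpow_sub_one hMpos.ne', Nat.cast_sub hj]
      congr 2
      · ring
      · rw [hε]; push_cast; ring
    rw [s3]
    have s4 : (N : ℝ) ^ (k + k * η' + 1) * (N : ℝ) ^ (-(k * η')) = N ^ k * N := by
      rw [← Real.rpow_add hNpos]
      rw [show (k : ℝ) + k * η' + 1 + -(k * η') = (k : ℝ) + 1 by ring, Real.rpow_add_one hNpos.ne',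
        Real.rpow_natCast]
    have s5 : (0 : ℝ) ≤ (N : ℝ) ^ (-(k * η')) := Real.rpow_nonneg hNpos.le _
    calc (N : ℝ) ^ k / M * c ≤ (N : ℝ) ^ k / M * N := by gcongr
      _ = ((N : ℝ) ^ (k + k * η' + 1) * (N : ℝ) ^ (-(k * η'))) / M := by rw [s4]; ring
      _ ≤ ((M : ℝ) ^ ε * (N : ℝ) ^ (-(k * η'))) / M := by gcongr
      _ = _ := by ring
  refine ⟨X, haN.trans hNX, fun m => (truncationMatrix k M * expansionMatrix k N p)
    (Fin.castLE hjk m), ?_, fun m => ⟨?_, fun i => ?_⟩⟩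
  · exact (Matrix.linearIndependent_rows_of_det_ne_zero
      (det_truncationMatrix_mul_expansionMatrix_ne_zero k M p hN0)).comp _
      (Fin.castLE_injective hjk)
  · beta_reduce
    rw [truncationMatrix_mul_expansionMatrix_zero]
    push_cast
    rw [abs_of_nonneg (by positivity), hX]
    have := m.2
    have h6 : (M : ℝ) ^ (m : ℕ) ≤ M ^ (j - 1) := pow_le_pow_right₀ hMr (by omega)
    exact mul_le_mul_of_nonneg_left h6 (by positivity)
  · refine le_trans ?_ hbound
    have hmk : (m : ℕ) ≤ k := by have := m.2; omega
    have t1 := abs_truncation_sub_le k p hN0 hM1 (Fin.castLE hjk m) i.succ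
    have t2 := hA (p / N + 1 / M) (by positivity) hβ (i.succ : ℕ) (by simp)
    have h0 : ((truncationMatrix k M * expansionMatrix k N p) (Fin.castLE hjk m) 0 : ℝ)
        = (N : ℝ) ^ k * M ^ (m : ℕ) := by
      rw [truncationMatrix_mul_expansionMatrix_zero]; simp
    rw [h0]
    simp only [succPowers, Fin.val_succ, Fin.val_castLE] at t1 t2 ⊢
    set V : ℝ := ((truncationMatrix k M * expansionMatrix k N p) (Fin.castLE hjk m) i.succ : ℝ)
    set β : ℝ := (p : ℝ) / N + 1 / M
    have t3 : ((p : ℝ) / N + 1) ^ ((i : ℕ) + 1) ≤ (ζ + 1) ^ k :=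
      (pow_le_pow_right₀ (by linarith) (by omega)).trans
        (pow_le_pow_left₀ (by linarith) (by linarith) _)
    have t4 : (N : ℝ) ^ k * M ^ (m : ℕ) * |ζ ^ ((i : ℕ) + 1) - β ^ ((i : ℕ) + 1)|
        ≤ (N : ℝ) ^ k / M * (2 * A) := by
      calc _ ≤ (N : ℝ) ^ k * M ^ k * (A * (2 / M ^ (k + 1))) := by
            gcongr
            exact t2.trans (mul_le_mul_of_nonneg_left h4 (by linarith))
        _ = _ := by rw [pow_succ]; field_simp
    have t5 : (N : ℝ) ^ k / M * ((p : ℝ) / N + 1) ^ ((i : ℕ) + 1)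
        ≤ (N : ℝ) ^ k / M * (ζ + 1) ^ k := mul_le_mul_of_nonneg_left t3 (by positivity)
    have e : ζ ^ ((i : ℕ) + 1) * ((N : ℝ) ^ k * M ^ (m : ℕ)) - V
        = (N : ℝ) ^ k * M ^ (m : ℕ) * (ζ ^ ((i : ℕ) + 1) - β ^ ((i : ℕ) + 1))
          + ((N : ℝ) ^ k * M ^ (m : ℕ) * β ^ ((i : ℕ) + 1) - V) := by ring
    rw [e, hc, mul_add]
    refine (abs_add_le _ _).trans (add_le_add ?_ (t1.trans t5))
    rw [abs_mul, abs_of_nonneg (by positivity)]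
    exact t4

/-! ### Lower bounds for the uniform constants. -/

/-- Dirichlet's theorem on simultaneous approximation. -/
theorem exists_simultaneous_approx {k : ℕ} (ζ : Fin k → ℝ) {Q : ℕ} (hQ : 1 ≤ Q) :
    ∃ v : Fin (k + 1) → ℤ, v 0 ≠ 0 ∧ |(v 0 : ℝ)| ≤ (Q : ℝ) ^ k ∧
      ∀ i : Fin k, |ζ i * (v 0 : ℝ) - (v i.succ : ℝ)| ≤ 1 / Q := by
  have hQr : (0 : ℝ) < Q := by exact_mod_cast hQ
  have hf : ∀ t : ℝ, ⌊(Q : ℝ) * Int.fract t⌋₊ < Q := fun t => by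
    rw [Nat.floor_lt (mul_nonneg hQr.le (Int.fract_nonneg t))]
    nlinarith [Int.fract_lt_one t]
  obtain ⟨x, y, hxy, h⟩ := Fintype.exists_ne_map_eq_of_card_lt
    (fun (x : Fin (Q ^ k + 1)) (i : Fin k) =>
      (⟨⌊(Q : ℝ) * Int.fract (ζ i * (x : ℕ))⌋₊, hf _⟩ : Fin Q)) (by simp)
  refine ⟨Fin.cons ((x : ℤ) - (y : ℤ)) fun i => ⌊ζ i * (x : ℕ)⌋ - ⌊ζ i * (y : ℕ)⌋, ?_, ?_, ?_⟩
  · rw [Fin.cons_zero, sub_ne_zero]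
    exact fun h => hxy (Fin.ext (by exact_mod_cast h))
  · rw [Fin.cons_zero]
    have hx : ((x : ℕ) : ℝ) ≤ (Q : ℝ) ^ k := by exact_mod_cast Nat.lt_succ_iff.1 x.2
    have hy : ((y : ℕ) : ℝ) ≤ (Q : ℝ) ^ k := by exact_mod_cast Nat.lt_succ_iff.1 y.2
    have hx0 : (0 : ℝ) ≤ (x : ℕ) := by positivity
    have hy0 : (0 : ℝ) ≤ (y : ℕ) := by positivity
    push_cast
    rw [abs_le]
    constructor <;> linarith
  · intro i
    have hi : ⌊(Q : ℝ) * Int.fract (ζ i * (x : ℕ))⌋₊ = ⌊(Q : ℝ) * Int.fract (ζ i * (y : ℕ))⌋₊ :=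
      congrArg Fin.val (congrFun h i)
    have e : ζ i * (((x : ℤ) - (y : ℤ) : ℤ) : ℝ) - ((⌊ζ i * (x : ℕ)⌋ - ⌊ζ i * (y : ℕ)⌋ : ℤ) : ℝ)
        = Int.fract (ζ i * (x : ℕ)) - Int.fract (ζ i * (y : ℕ)) := by
      simp only [Int.fract]; push_cast; ring
    rw [Fin.cons_zero, Fin.cons_succ, e, le_div_iff₀ hQr]
    nth_rw 1 [← abs_of_pos hQr]
    rw [← abs_mul]
    have a1 := Nat.floor_le (mul_nonneg hQr.le (Int.fract_nonneg (ζ i * (x : ℕ))))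
    have a2 := Nat.lt_floor_add_one ((Q : ℝ) * Int.fract (ζ i * (x : ℕ)))
    have b1 := Nat.floor_le (mul_nonneg hQr.le (Int.fract_nonneg (ζ i * (y : ℕ))))
    have b2 := Nat.lt_floor_add_one ((Q : ℝ) * Int.fract (ζ i * (y : ℕ)))
    rw [hi] at a1 a2
    rw [abs_le]
    constructor <;> nlinarith

theorem eventually_hasIndepSolutions_one {k : ℕ} (hk : 1 ≤ k) (ζ : Fin k → ℝ) {η : ℝ}
    (hη : η < 1 / k) : ∀ᶠ X : ℝ in atTop, HasIndepSolutions ζ 1 η X := by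
  have hk0 : (0 : ℝ) < k := by exact_mod_cast hk
  filter_upwards [eventually_ge_atTop 1,
    (tendsto_rpow_atTop (sub_pos.2 hη)).eventually_ge_atTop 2] with X hX h2
  have hX0 : 0 < X := by linarith
  set Y : ℝ := X ^ (1 / (k : ℝ)) with hY
  have hY1 : 1 ≤ Y := Real.one_le_rpow hX (by positivity)
  have hQ : 1 ≤ ⌊Y⌋₊ := Nat.le_floor (by simpa using hY1)
  have hQr : (1 : ℝ) ≤ ⌊Y⌋₊ := by exact_mod_cast hQ
  -- The factor 2 lost to the floor is absorbed by X^(1/k - η) ≥ 2.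
  have hQY : Y ≤ 2 * ⌊Y⌋₊ := by linarith [Nat.lt_floor_add_one Y]
  obtain ⟨v, hv0, hv1, hv2⟩ := exists_simultaneous_approx ζ hQ
  refine ⟨fun _ => v, ?_, fun _ => ⟨hv1.trans ?_, fun i => (hv2 i).trans ?_⟩⟩
  · rw [linearIndependent_unique_iff]
    exact fun h => hv0 (congrFun h 0)
  · calc (⌊Y⌋₊ : ℝ) ^ k ≤ Y ^ k := pow_le_pow_left₀ (by positivity) (Nat.floor_le (by linarith)) _
      _ = X := by
        rw [hY, ← Real.rpow_natCast, ← Real.rpow_mul hX0.le, one_div_mul_cancel hk0.ne',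
          Real.rpow_one]
  · have e : X ^ (-η) = X ^ (1 / (k : ℝ) - η) / Y := by
      rw [hY, ← Real.rpow_sub hX0]; congr 1; ring
    rw [e, div_le_div_iff₀ (by linarith) (by linarith)]
    nlinarith

theorem eventually_hasIndepSolutions_of_neg {k : ℕ} (ζ : Fin k → ℝ) {j : ℕ} (hj : j ≤ k + 1)
    {η : ℝ} (hη : η < 0) : ∀ᶠ X : ℝ in atTop, HasIndepSolutions ζ j η X := by
  obtain ⟨Z, hZ⟩ : ∃ Z : ℝ, ∀ i, |ζ i| ≤ Z :=
    ⟨∑ i, |ζ i|, fun i => Finset.single_le_sum (f := fun i => |ζ i|)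
      (fun _ _ => abs_nonneg _) (Finset.mem_univ i)⟩
  filter_upwards [eventually_ge_atTop 1,
    (tendsto_rpow_atTop (neg_pos.2 hη)).eventually_ge_atTop (max Z 1)] with X hX h2
  refine ⟨fun a => Pi.single (Fin.castLE hj a) 1,
    (Pi.linearIndependent_single_one (Fin (k + 1)) ℤ).comp _ (Fin.castLE_injective hj),
    fun a => ?_⟩
  change IsApproxSolution ζ η X (Pi.single (Fin.castLE hj a) 1)
  refine Fin.cases ?_ (fun b => ?_) (Fin.castLE hj a)
  · refine ⟨by simpa using hX, fun i => ?_⟩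
    simpa using (hZ i).trans ((le_max_left _ _).trans h2)
  · refine ⟨?_, fun i => ?_⟩
    · rw [Pi.single_eq_of_ne (Fin.succ_ne_zero b).symm]; simpa using by linarith
    · rw [Pi.single_eq_of_ne (Fin.succ_ne_zero b).symm, Int.cast_zero, mul_zero, zero_sub, abs_neg]
      refine le_trans ?_ ((le_max_right _ _).trans h2)
      by_cases h : i = b
      · subst h; simp
      · rw [Pi.single_eq_of_ne (fun h' => h (Fin.succ_injective _ h'))]; simp

/-! ### Upper bounds for the uniform constants. -/

theorem not_eventually_hasIndepSolutions_two {k : ℕ} {ζ : ℝ} (hL : HasLacunaryApprox k ζ)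
    {j : ℕ} (hj : 2 ≤ j) {η : ℝ} (hη : 0 < η) :
    ¬ ∀ᶠ X : ℝ in atTop, HasIndepSolutions (succPowers k ζ) j η X := by
  rw [eventually_atTop]
  rintro ⟨X₀, hX₀⟩
  obtain ⟨A, hA1, hA⟩ := exists_pow_sub_pow_le k ζ
  obtain ⟨K, hK⟩ := exists_nat_ge ((k + 1) / η)
  have hKη : (k : ℝ) + 1 ≤ K * η := (div_le_iff₀ hη).1 hK
  have hK1 : K ≠ 0 := by
    rintro rfl
    have : (0 : ℝ) ≤ k := by positivity
    simp at hKη; linarith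
  obtain ⟨B, hB⟩ := exists_nat_gt (max X₀ (1 + 2 * A))
  -- With X = N^K, both X^(-η) and X/M are at most N^(-(k+1)).
  obtain ⟨N, M, p, hBN, hN2, -, hNM, h1, h2, -, -⟩ := hL (K + (k + 1)) B
  have hN0 : (0 : ℝ) < N := by positivity
  have hN1 : (1 : ℝ) ≤ N := by exact_mod_cast (by omega : 1 ≤ N)
  have hM0 : (0 : ℝ) < M := by exact_mod_cast (by omega : 0 < M)
  have hBN' : max X₀ (1 + 2 * A) < N := hB.trans_le (by exact_mod_cast hBN)
  have hNX : (N : ℝ) ≤ N ^ K := le_self_pow₀ hN1 hK1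
  obtain ⟨v, hli, hv⟩ := hX₀ ((N : ℝ) ^ K) (((le_max_left _ _).trans hBN'.le).trans hNX)
  have hα0 : (0 : ℝ) ≤ p / N := by positivity
  have herr : ((N : ℝ) ^ K) ^ (-η) ≤ 1 / N ^ (k + 1) := by
    rw [← Real.rpow_natCast, ← Real.rpow_mul hN0.le, ← Real.rpow_natCast (N : ℝ) (k + 1),
      one_div, ← Real.rpow_neg hN0.le]
    exact Real.rpow_le_rpow_of_exponent_le hN1 (by push_cast; linarith)
  have hMlow : (N : ℝ) ^ K / M ≤ 1 / N ^ (k + 1) := by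
    rw [div_le_div_iff₀ hM0 (by positivity), ← pow_add, one_mul]
    exact_mod_cast hNM.le
  -- N^k times the difference of the two sides is an integer of size at most (1 + 2A)/N < 1.
  have key : ∀ (a : Fin j) (i : Fin k), (v a i.succ : ℝ) = (p / N : ℝ) ^ ((i : ℕ) + 1) * v a 0 := by
    intro a i
    obtain ⟨hx, hy⟩ := hv a
    have hy := (hy i).trans herr
    have hA' := hA _ hα0 (by linarith) ((i : ℕ) + 1) (by omega)
    simp only [succPowers] at hy
    have hint : (N : ℝ) ^ k * (p / N : ℝ) ^ ((i : ℕ) + 1)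
        = ((p ^ ((i : ℕ) + 1) * N ^ (k - ((i : ℕ) + 1)) : ℤ) : ℝ) := by
      have hd : (N : ℝ) ^ k = N ^ (k - ((i : ℕ) + 1)) * N ^ ((i : ℕ) + 1) := by
        rw [← pow_add]; congr 1; omega
      rw [hd, div_pow]
      push_cast
      field_simp
    set z : ℤ := (p ^ ((i : ℕ) + 1) * N ^ (k - ((i : ℕ) + 1)) : ℤ) with hz
    have hdiff : |(p / N : ℝ) ^ ((i : ℕ) + 1) * v a 0 - v a i.succ| ≤ (1 + 2 * A) / N ^ (k + 1) := by
      have e : (p / N : ℝ) ^ ((i : ℕ) + 1) * v a 0 - v a i.succ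
          = (ζ ^ ((i : ℕ) + 1) * v a 0 - v a i.succ)
            - (ζ ^ ((i : ℕ) + 1) - (p / N : ℝ) ^ ((i : ℕ) + 1)) * v a 0 := by ring
      rw [e]
      refine (abs_sub _ _).trans ?_
      have : |(ζ ^ ((i : ℕ) + 1) - (p / N : ℝ) ^ ((i : ℕ) + 1)) * (v a 0 : ℝ)|
          ≤ 2 * A * (1 / N ^ (k + 1)) := by
        rw [abs_mul]
        calc _ ≤ (A * (2 / M)) * (N : ℝ) ^ K :=
              mul_le_mul (hA'.trans (mul_le_mul_of_nonneg_left h2 (by linarith))) hx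
                (abs_nonneg _) (by positivity)
          _ = 2 * A * ((N : ℝ) ^ K / M) := by ring
          _ ≤ _ := mul_le_mul_of_nonneg_left hMlow (by linarith)
      calc _ ≤ 1 / (N : ℝ) ^ (k + 1) + 2 * A * (1 / N ^ (k + 1)) := add_le_add hy this
        _ = _ := by ring
    have hlt : |((z * v a 0 - (N : ℤ) ^ k * v a i.succ : ℤ) : ℝ)| < 1 := by
      have e : ((z * v a 0 - (N : ℤ) ^ k * v a i.succ : ℤ) : ℝ)
          = (N : ℝ) ^ k * ((p / N : ℝ) ^ ((i : ℕ) + 1) * v a 0 - v a i.succ) := by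
        push_cast
        rw [← hint]; ring
      rw [e, abs_mul, abs_of_nonneg (by positivity)]
      calc _ ≤ (N : ℝ) ^ k * ((1 + 2 * A) / N ^ (k + 1)) :=
            mul_le_mul_of_nonneg_left hdiff (by positivity)
        _ = (1 + 2 * A) / N := by rw [pow_succ]; field_simp
        _ < 1 := by rw [div_lt_one hN0]; exact (le_max_right _ _).trans_lt hBN'
    have hzero : z * v a 0 - (N : ℤ) ^ k * v a i.succ = 0 :=
      Int.abs_lt_one_iff.1 (by exact_mod_cast hlt)
    have hzero' : (z : ℝ) * v a 0 = (N : ℝ) ^ k * v a i.succ := by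
      exact_mod_cast sub_eq_zero.1 hzero
    rw [← hint] at hzero'
    have : (N : ℝ) ^ k ≠ 0 := by positivity
    apply mul_left_cancel₀ this
    rw [← hzero']; ring
  have hpair := hli.comp ![(⟨0, by omega⟩ : Fin j), ⟨1, by omega⟩] (by
    intro x y; fin_cases x <;> fin_cases y <;> simp)
  set a : Fin j := ⟨0, by omega⟩
  set b : Fin j := ⟨1, by omega⟩
  have hpair' : LinearIndependent ℤ ![v a, v b] := by
    convert hpair using 1
    ext x; fin_cases x <;> rfl
  rw [LinearIndependent.pair_iff] at hpair'
  have hdep : v b 0 • v a + (-v a 0) • v b = 0 := by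
    ext i
    refine Fin.cases ?_ (fun i => ?_) i
    · simp; ring
    · have : (v b 0 : ℝ) * v a i.succ + (-v a 0) * v b i.succ = 0 := by
        rw [key a i, key b i]; ring
      simp only [Pi.add_apply, Pi.smul_apply, smul_eq_mul, Pi.zero_apply]
      exact_mod_cast this
  have ha0 : v a 0 = 0 := neg_eq_zero.1 (hpair' _ _ hdep).2
  apply hli.ne_zero a
  ext i
  refine Fin.cases ha0 (fun i => ?_) i
  have := key a i
  rw [ha0, Int.cast_zero, mul_zero] at this
  exact_mod_cast this

/-- The reduced fraction `a / b` of `p / N + 1 / (N c)` has `c ≤ b ≤ N c`. -/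
theorem exists_coprime_eq_div_add {N c p : ℕ} (hN : 0 < N) (hc : 0 < c) :
    ∃ a b : ℕ, a.Coprime b ∧ c ≤ b ∧ b ≤ N * c ∧
      (p : ℝ) / N + 1 / (N * c : ℕ) = a / b := by
  have hM : 0 < N * c := Nat.mul_pos hN hc
  set g := (p * c + 1).gcd (N * c) with hg
  have hg0 : 0 < g := Nat.gcd_pos_of_pos_right _ hM
  have h1 : g * ((p * c + 1) / g) = p * c + 1 := Nat.mul_div_cancel' (Nat.gcd_dvd_left _ _)
  have h2 : g * ((N * c) / g) = N * c := Nat.mul_div_cancel' (Nat.gcd_dvd_right _ _)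
  have hb0 : 0 < (N * c) / g := Nat.div_pos (Nat.le_of_dvd hM (Nat.gcd_dvd_right _ _)) hg0
  refine ⟨(p * c + 1) / g, (N * c) / g, Nat.coprime_div_gcd_div_gcd hg0, ?_,
    Nat.div_le_self _ _, ?_⟩
  -- The gcd g divides pc + 1, so it is prime to c; hence c divides Nc/g.
  · have hcg : c.Coprime g := by
      refine Nat.Coprime.coprime_dvd_right (Nat.gcd_dvd_left _ _) ?_
      rw [Nat.coprime_mul_right_add_right]
      exact Nat.coprime_one_right c
    exact Nat.le_of_dvd hb0 (hcg.dvd_of_dvd_mul_left (h2.symm ▸ Dvd.intro_left N rfl))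
  · have hNr : (N : ℝ) ≠ 0 := by positivity
    have hcr : (c : ℝ) ≠ 0 := by positivity
    have hgr : (g : ℝ) ≠ 0 := by positivity
    have hbr : (((N * c) / g : ℕ) : ℝ) ≠ 0 := by positivity
    have e1 : (g : ℝ) * (((p * c + 1) / g : ℕ) : ℝ) = p * c + 1 := by exact_mod_cast h1
    have e2 : (g : ℝ) * (((N * c) / g : ℕ) : ℝ) = N * c := by exact_mod_cast h2
    rw [← mul_div_mul_left _ (((N * c) / g : ℕ) : ℝ) hgr, e1, e2]
    push_cast
    field_simp

/-- Induction on i: if x = b^i z, then b((a/b)^(i+1) x - y) = a^(i+1) z - b y is an integer below 1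
in absolute value, hence 0, and coprimality gives b ∣ z. -/
theorem pow_dvd_of_abs_sub_lt {k a b : ℕ} (hb : 0 < b) (hab : a.Coprime b)
    {v : Fin (k + 1) → ℤ}
    (h : ∀ i : Fin k, |(a / b : ℝ) ^ ((i : ℕ) + 1) * v 0 - v i.succ| < 1 / b) (i : ℕ)
    (hi : i ≤ k) : (b : ℤ) ^ i ∣ v 0 := by
  have hbr : (0 : ℝ) < b := by exact_mod_cast hb
  induction i with
  | zero => simp
  | succ i ih =>
    obtain ⟨z, hz⟩ := ih (by omega)
    have hi' := h ⟨i, by omega⟩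
    set y := v (Fin.succ ⟨i, by omega⟩)
    have hlt : |((a ^ (i + 1) * z - b * y : ℤ) : ℝ)| < 1 := by
      have e : ((a ^ (i + 1) * z - b * y : ℤ) : ℝ)
          = b * ((a / b : ℝ) ^ (i + 1) * v 0 - y) := by
        rw [hz]; push_cast; rw [div_pow, pow_succ (b : ℝ)]; field_simp
      rw [e, abs_mul, abs_of_pos hbr]
      calc _ < (b : ℝ) * (1 / b) := mul_lt_mul_of_pos_left hi' hbr
        _ = 1 := by field_simp
    have hzero : (a : ℤ) ^ (i + 1) * z - b * y = 0 :=
      Int.abs_lt_one_iff.1 (by exact_mod_cast hlt)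
    have hcop : IsCoprime (b : ℤ) ((a : ℤ) ^ (i + 1)) :=
      (Nat.isCoprime_iff_coprime.2 hab.symm).pow_right
    have hdz : (b : ℤ) ∣ z := hcop.dvd_of_dvd_mul_left ⟨y, sub_eq_zero.1 hzero⟩
    rw [hz, pow_succ]
    exact mul_dvd_mul_left _ hdz

theorem not_eventually_hasIndepSolutions_one {k : ℕ} (hk : 1 ≤ k) {ζ : ℝ}
    (hL : HasLacunaryApprox k ζ) {η : ℝ} (hη : 1 / (k : ℝ) < η) :
    ¬ ∀ᶠ X : ℝ in atTop, HasIndepSolutions (succPowers k ζ) 1 η X := by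
  rw [eventually_atTop]
  rintro ⟨X₀, hX₀⟩
  obtain ⟨A, hA1, hA⟩ := exists_pow_sub_pow_le k ζ
  have hk0 : (0 : ℝ) < k := by exact_mod_cast hk
  have hηk : 0 < k * η - 1 := by
    rw [div_lt_iff₀ hk0] at hη; linarith
  -- With X = b^k / D, replacing ζ by a/b costs at most A (2/b^(k+1)) X = 1/(4b); D > 1 also gives X
  -- < b^k.
  set D : ℝ := 8 * A with hD
  have hD0 : 0 < D := by linarith
  obtain ⟨T, hT⟩ := eventually_atTop.1 ((tendsto_rpow_atTop hηk).eventually_ge_atTop (4 * D ^ η))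
  obtain ⟨B, hB⟩ := exists_nat_ge (max (D * X₀) T)
  -- Exponent 2 gives N < c ≤ b, so the reduced denominator b is large too.
  obtain ⟨N, M, p, hBN, hN2, ⟨c, rfl⟩, hNM, h1, -, h3, h4⟩ := hL 2 B
  have hNc : N < c := by
    rw [pow_two] at hNM
    exact lt_of_mul_lt_mul_left hNM (by omega)
  obtain ⟨a, b, hab, hcb, hbM, hβ⟩ := exists_coprime_eq_div_add (p := p)
    (by omega : 0 < N) (by omega : 0 < c)
  rw [hβ] at h3 h4
  have hb0 : 0 < b := by omega
  have hbr : (1 : ℝ) ≤ b := by exact_mod_cast hb0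
  have hbr0 : (0 : ℝ) < b := by linarith
  have hbB : max (D * X₀) T ≤ b := hB.trans (by exact_mod_cast (by omega : B ≤ b))
  have hMb : 2 / ((N * c : ℕ) : ℝ) ^ (k + 1) ≤ 2 / (b : ℝ) ^ (k + 1) :=
    div_le_div_of_nonneg_left (by norm_num) (by positivity)
      (pow_le_pow_left₀ (by positivity) (by exact_mod_cast hbM) _)
  set X : ℝ := (b : ℝ) ^ k / D with hX
  have hX0 : 0 < X := by positivity
  have hXX : X₀ ≤ X := by
    rw [hX, le_div_iff₀ hD0]
    have h5 : (b : ℝ) ≤ b ^ k := le_self_pow₀ hbr (by omega)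
    linarith [(le_max_left (D * X₀) T).trans hbB]
  obtain ⟨v, hli, hv⟩ := hX₀ X hXX
  have herr : X ^ (-η) ≤ 1 / (4 * b) := by
    have e : X ^ (-η) = D ^ η / (b : ℝ) ^ (k * η) := by
      rw [hX, Real.div_rpow (by positivity) hD0.le, Real.rpow_neg hD0.le, div_inv_eq_mul,
        ← Real.rpow_natCast, ← Real.rpow_mul hbr0.le, mul_neg, Real.rpow_neg hbr0.le]
      ring
    have hTb := hT b ((le_max_right _ _).trans hbB)
    rw [Real.rpow_sub_one hbr0.ne', le_div_iff₀ hbr0] at hTb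
    rw [e, div_le_div_iff₀ (by positivity) (by positivity)]
    linarith
  have hw := hv 0
  set w := v 0 with hwdef
  have hdiff : ∀ i : Fin k, |(a / b : ℝ) ^ ((i : ℕ) + 1) * w 0 - w i.succ| ≤ 1 / (2 * b) := by
    intro i
    have hy := (hw.2 i).trans herr
    simp only [succPowers] at hy
    have hA' := hA (a / b) (by positivity) (by linarith) ((i : ℕ) + 1) (by omega)
    have e : (a / b : ℝ) ^ ((i : ℕ) + 1) * w 0 - w i.succ
        = (ζ ^ ((i : ℕ) + 1) * w 0 - w i.succ)
          - (ζ ^ ((i : ℕ) + 1) - (a / b : ℝ) ^ ((i : ℕ) + 1)) * w 0 := by ring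
    have : |(ζ ^ ((i : ℕ) + 1) - (a / b : ℝ) ^ ((i : ℕ) + 1)) * (w 0 : ℝ)| ≤ 1 / (4 * b) := by
      rw [abs_mul]
      calc _ ≤ (A * (2 / (b : ℝ) ^ (k + 1))) * X :=
            mul_le_mul (hA'.trans (mul_le_mul_of_nonneg_left (h4.trans hMb) (by linarith))) hw.1
              (abs_nonneg _) (by positivity)
        _ = 1 / (4 * b) := by rw [hX, hD, pow_succ]; field_simp; norm_num
    rw [e]
    refine (abs_sub _ _).trans ((add_le_add hy this).trans (le_of_eq ?_))
    field_simp; norm_num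
  have hdvd : (b : ℤ) ^ k ∣ w 0 := by
    refine pow_dvd_of_abs_sub_lt hb0 hab (fun i => (hdiff i).trans_lt ?_) k le_rfl
    rw [div_lt_div_iff₀ (by positivity) hbr0]; linarith
  have hw0 : w 0 = 0 := by
    refine Int.eq_zero_of_abs_lt_dvd hdvd ?_
    have : |(w 0 : ℝ)| < (b : ℝ) ^ k :=
      hw.1.trans_lt (div_lt_self (by positivity) (by linarith))
    exact_mod_cast this
  apply hli.ne_zero 0
  ext i
  refine Fin.cases hw0 (fun i => ?_) i
  have h5 := hdiff i
  rw [hw0, Int.cast_zero, mul_zero, zero_sub, abs_neg] at h5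
  have h6 : |(w i.succ : ℝ)| < 1 := by
    refine h5.trans_lt ?_
    rw [div_lt_one (by positivity)]; linarith
  exact Int.abs_lt_one_iff.1 (by exact_mod_cast h6)

theorem mainTheorem2 (k : ℕ) (hk : 1 ≤ k) (q : ℕ → ℕ)
    (hpos : ∀ l, 0 < q l)
    (hdvd : ∀ l, q l ∣ q (l + 1))
    (hlt : ∀ l, q l < q (l + 1))
    (hgrowth : ∀ C : ℝ, 0 < C → ∃ n : ℕ, 1 < q n ∧
      C < Real.log (q (n + 1) : ℝ) / Real.log (q n : ℝ) ∧
      (k : ℝ) + 1 < Real.log (q (n + 2) : ℝ) / Real.log (q (n + 1) : ℝ))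
    (ζ : ℝ) (hζ : ζ = ∑' l : ℕ, 1 / (q l : ℝ)) :
    Summable (fun l : ℕ => 1 / (q l : ℝ)) ∧
    approxConst (succPowers k ζ) 1 = ⊤ ∧
    (∀ j : ℕ, 2 ≤ j → j ≤ k + 1 →
      approxConst (succPowers k ζ) j = ((1 / ((j : ℝ) - 1) : ℝ) : EReal)) ∧
    uniformApproxConst (succPowers k ζ) 1 = ((1 / (k : ℝ) : ℝ) : EReal) ∧
    (∀ j : ℕ, 2 ≤ j → j ≤ k + 1 → uniformApproxConst (succPowers k ζ) j = 0) := by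
  have hL : HasLacunaryApprox k ζ := hζ ▸ hasLacunaryApprox_of_growth hpos hdvd hlt hgrowth
  refine ⟨summable_one_div hpos hdvd hlt, ?_, fun j hj hjk => ?_, ?_, fun j hj hjk => ?_⟩
  · exact sSup_coe_image_eq_top fun η =>
      frequently_hasIndepSolutions hk hL le_rfl (by omega) (by simp)
  · have hj1 : (0 : ℝ) < (j : ℝ) - 1 := by
      have : (2 : ℝ) ≤ j := by exact_mod_cast hj
      linarith
    exact sSup_coe_image_eq
      (fun η hη => frequently_hasIndepSolutions hk hL (by omega) hjk ((lt_div_iff₀ hj1).1 hη))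
      fun η hη => not_frequently_hasIndepSolutions _ hj hη
  · exact sSup_coe_image_eq (fun η hη => eventually_hasIndepSolutions_one hk _ hη)
      fun η hη => not_eventually_hasIndepSolutions_one hk hL hη
  · exact sSup_coe_image_eq (c := 0)
      (fun η hη => eventually_hasIndepSolutions_of_neg _ hjk hη)
      fun η hη => not_eventually_hasIndepSolutions_two hL hj hη
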